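/- Let $X$ be a metric space. For an integer $m\ge 0$, write $\dim_{NA}(X)\le m$ ($X$ has Nagata--Assouad dimension at most $m$) if there is a constant $C>0$ such that for every $r>0$ there is a cover $\mathcal U=\bigcup_{i=1}^{m+1}\mathcal U_i$ of $X$ such that each family $\mathcal U_i$ is $r$-disjoint (that is, $d(x,y)\ge r$ whenever $x\in U$, $y\in V$ for distinct $U,V\in\mathcal U_i$) and every element of $\mathcal U$ has diameter at most $C\cdot r$. A metric space $E$ is a Lipschitz extensor of $X$ if there is a constant $C>0$ such that for every $\lambda\ge 0$ and every subset $A\subseteq X$, any $\lambda$-Lipschitz map $f:A\to E$ extends to a $C\lambda$-Lipschitz map $\tilde f:X\to E$. Let $$S^n=\partial\Delta^{n+1}=\Big\{x\in\mathbb R^{n+2} : x_i\ge 0 \text{ for all } i,\ \sum_i x_i=1,\ x_i=0\text{ for some } i\Big\}$$ be the boundary of the standard $(n+1)$-simplex, with the metric induced by either the $\ell_1$ norm or the $\ell_2$ norm of $\mathbb R^{n+2}$. Theorem. Suppose that $X$ has finite Nagata--Assouad dimension, i.e. $\dim_{NA}(X)\le m$ for some integer $m\ge 0$, and let $n\ge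 0$ be an integer. Then $S^n$ is a Lipschitz extensor of $X$ if and only if $\dim_{NA}(X)\le n$. -/

import Mathlib

open scoped NNReal ENNReal

/-- A family `𝒰` of subsets of a metric space is `r`-disjoint if points lying in two different
members of `𝒰` are at distance at least `r`. -/
def RDisjoint {X : Type*} [MetricSpace X] (r : ℝ) (𝒰 : Set (Set X)) : Prop :=
  ∀ U ∈ 𝒰, ∀ V ∈ 𝒰, U ≠ V → ∀ x ∈ U, ∀ y ∈ V, r ≤ dist x y

/-- `X` has Nagata–Assouad dimension at most `n`: there is `C > 0` such that for every `r > 0`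
there are `n + 1` families of subsets of `X`, each of them `r`-disjoint, which together cover `X`
and whose members all have diameter at most `C * r`. -/
def NagataDimLE (X : Type*) [MetricSpace X] (n : ℕ) : Prop :=
  ∃ C : ℝ, 0 < C ∧ ∀ r : ℝ, 0 < r →
    ∃ 𝒰 : Fin (n + 1) → Set (Set X),
      (∀ x : X, ∃ i, ∃ U ∈ 𝒰 i, x ∈ U) ∧
      (∀ i, RDisjoint r (𝒰 i)) ∧
      (∀ i, ∀ U ∈ 𝒰 i, ∀ x ∈ U, ∀ y ∈ U, dist x y ≤ C * r)

/-- `E` is a Lipschitz extensor of `X`: there is `C > 0` such that every `K`-Lipschitz map from a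
subset of `X` to `E` extends to a `(C * K)`-Lipschitz map from `X` to `E`. -/
def IsLipschitzExtensor (E X : Type*) [MetricSpace E] [MetricSpace X] : Prop :=
  ∃ C : ℝ≥0, 0 < C ∧ ∀ (K : ℝ≥0) (A : Set X) (f : A → E), LipschitzWith K f →
    ∃ g : X → E, LipschitzWith (C * K) g ∧ ∀ a : A, g a = f a

/-- The `n`-sphere `∂Δ^{n+1}`: the boundary of the standard `(n+1)`-simplex, consisting of the
points of the simplex that have a vanishing barycentric coordinate, as a subset of `ℝ^{n+2}` with
the `ℓ_p` norm (whose metric it carries). -/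
def simplexSphere (p : ℝ≥0∞) (n : ℕ) : Set (PiLp p (fun _ : Fin (n + 2) => ℝ)) :=
  {x | x.ofLp ∈ stdSimplex ℝ (Fin (n + 2)) ∧ ∃ i, x i = 0}

/-! If `Sⁿ` is a Lipschitz extensor of `X` and `dim_NA X ≤ n + 1`, map `X` to the `(n + 1)`-simplex
by a partition of unity subordinate to a cover at scale `r`, and replace this map by a Lipschitz map
into `Sⁿ` that agrees with it wherever it already takes values in `Sⁿ`. At every point some `k`
coordinates of the new map, with `1 ≤ k ≤ n + 1`, exceed the others by a definite gap. Sorting the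
points by these coordinates gives one family of sets for each `k`, so `dim_NA X ≤ n`. As the
suspension of a Lipschitz extensor is again one, `Sⁿ` being an extensor makes every higher sphere an
extensor, and the dimension of `X` can be lowered one step at a time.

Conversely, if `dim_NA X ≤ n`, extend `A → Sⁿ` to a map into the `(n + 1)`-simplex and approximate
it by a map into finitely many simplices of dimension `n`, which miss a generic point `q`. Using the
approximation only near `q`, one can then project radially from `q` to the boundary. -/

section Lipschitz

lemma lipschitzWith_pi {X ι : Type*} {E : ι → Type*} [PseudoEMetricSpace X] [Fintype ι]
    [∀ i, PseudoEMetricSpace (E i)] {f : X → ∀ i, E i} {K : ℝ≥0}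
    (hf : ∀ i, LipschitzWith K fun x => f x i) : LipschitzWith K f :=
  fun x y => edist_pi_le_iff.2 fun i => hf i x y

variable {X E F : Type*} [PseudoMetricSpace X] [SeminormedAddCommGroup E]
  [SeminormedAddCommGroup F] [NormedSpace ℝ F]

lemma lipschitzWith_finset_sum {ι : Type*} {f : ι → X → E} {K : ℝ≥0} (s : Finset ι)
    (hf : ∀ i ∈ s, LipschitzWith K (f i)) :
    LipschitzWith (s.card * K) fun x => ∑ i ∈ s, f i x := by
  refine LipschitzWith.of_dist_le_mul fun x y => (dist_sum_sum_le _ _ _).trans ?_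
  calc ∑ i ∈ s, dist (f i x) (f i y) ≤ s.card • (K * dist x y) :=
        Finset.sum_le_card_nsmul _ _ _ fun i hi => (hf i hi).dist_le_mul x y
    _ = (s.card * K : ℝ≥0) * dist x y := by rw [nsmul_eq_mul]; push_cast; ring

lemma lipschitzWith_indicator {S : Set X} {φ : X → E} {K : ℝ≥0} (hφ : LipschitzOnWith K φ S)
    (h : ∀ x ∈ S, ∀ z ∉ S, ‖φ x‖ ≤ K * dist x z) : LipschitzWith K (S.indicator φ) := by
  refine LipschitzWith.of_dist_le_mul fun x z => ?_
  by_cases hx : x ∈ S <;> by_cases hz : z ∈ S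
  · simpa only [Set.indicator_of_mem, hx, hz] using hφ.dist_le_mul x hx z hz
  · simpa only [Set.indicator_of_mem hx, Set.indicator_of_notMem hz, dist_zero_right]
      using h x hx z hz
  · simpa only [Set.indicator_of_mem hz, Set.indicator_of_notMem hx, dist_zero_left, dist_comm x]
      using h z hz x hx
  · simp only [Set.indicator_of_notMem, hx, hz, not_false_eq_true, dist_self]
    positivity

lemma lipschitzWith_smul_const_of_norm_le_one {c : X → ℝ} {K : ℝ≥0} (hc : LipschitzWith K c)
    {v : F} (hv : ‖v‖ ≤ 1) : LipschitzWith K fun x => c x • v := by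
  refine LipschitzWith.of_dist_le_mul fun x y => ?_
  rw [dist_eq_norm, ← sub_smul, norm_smul, ← dist_eq_norm]
  exact (mul_le_of_le_one_right dist_nonneg hv).trans (hc.dist_le_mul x y)

lemma lipschitzWith_lineMap_of_dist_le {u v : X → F} {t : X → ℝ} {a b c D : ℝ≥0}
    (hu : LipschitzWith a u) (hv : LipschitzWith b v) (ht : LipschitzWith c t)
    (ht01 : ∀ x, t x ∈ Set.Icc (0 : ℝ) 1) (hD : ∀ x, dist (u x) (v x) ≤ D) :
    LipschitzWith (a + b + D * c) fun x => AffineMap.lineMap (u x) (v x) (t x) := by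
  refine LipschitzWith.of_dist_le_mul fun x y => ?_
  have split : AffineMap.lineMap (u x) (v x) (t x) - AffineMap.lineMap (u y) (v y) (t y)
      = (1 - t x) • (u x - u y) + t x • (v x - v y) + (t x - t y) • (v y - u y) := by
    simp only [AffineMap.lineMap_apply_module]
    module
  have hu' : ‖(1 - t x) • (u x - u y)‖ ≤ a * dist x y := by
    rw [norm_smul, ← dist_eq_norm (u x), Real.norm_of_nonneg (sub_nonneg.2 (ht01 x).2)]
    exact (mul_le_of_le_one_left dist_nonneg (sub_le_self _ (ht01 x).1)).trans (hu.dist_le_mul x y)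
  have hv' : ‖t x • (v x - v y)‖ ≤ b * dist x y := by
    rw [norm_smul, ← dist_eq_norm (v x), Real.norm_of_nonneg (ht01 x).1]
    exact (mul_le_of_le_one_left dist_nonneg (ht01 x).2).trans (hv.dist_le_mul x y)
  have ht' : ‖(t x - t y) • (v y - u y)‖ ≤ c * dist x y * D := by
    rw [norm_smul, ← dist_eq_norm, ← dist_eq_norm, dist_comm (v y)]
    gcongr
    exacts [ht.dist_le_mul x y, hD y]
  rw [dist_eq_norm, split]
  calc _ ≤ a * dist x y + b * dist x y + c * dist x y * D :=
        norm_add₃_le.trans (by gcongr)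
    _ = (a + b + D * c : ℝ≥0) * dist x y := by push_cast; ring

lemma exists_lipschitzWith_interpolation {u v : X → F} {φ : X → ℝ} {a b c D δ : ℝ≥0}
    (hu : LipschitzWith a u) (hv : LipschitzWith b v) (hφ : LipschitzWith c φ)
    (hD : ∀ x, dist (u x) (v x) ≤ D) (α : ℝ) (hδ : 0 < δ) :
    ∃ w : X → F, LipschitzWith (a + b + D * (c / δ)) w ∧ (∀ x, w x ∈ segment ℝ (u x) (v x)) ∧
      (∀ x, φ x ≤ α → w x = u x) ∧ ∀ x, α + δ ≤ φ x → w x = v x := by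
  have hδ' : (0 : ℝ) < δ := hδ
  set t : X → ℝ := fun x => Set.projIcc (0 : ℝ) 1 zero_le_one ((φ x - α) / δ) with t_def
  have ht : LipschitzWith (c / δ) t := by
    have hscale : LipschitzWith (c / δ) fun x => (φ x - α) / δ := by
      refine LipschitzWith.of_dist_le_mul fun x y => ?_
      rw [Real.dist_eq, ← sub_div, sub_sub_sub_cancel_right, abs_div, abs_of_pos hδ',
        NNReal.coe_div, div_mul_eq_mul_div]
      gcongr
      exact hφ.dist_le_mul x y
    have hproj := (LipschitzWith.subtype_val (Set.Icc (0 : ℝ) 1)).comp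
      (LipschitzWith.projIcc zero_le_one)
    simpa only [one_mul] using! hproj.comp hscale
  refine ⟨fun x => AffineMap.lineMap (u x) (v x) (t x),
    lipschitzWith_lineMap_of_dist_le hu hv ht (fun x => Subtype.prop _) hD, fun x => ?_,
    fun x hx => ?_, fun x hx => ?_⟩
  · rw [segment_eq_image_lineMap]
    exact ⟨t x, Subtype.prop _, rfl⟩
  · have : t x = 0 := by
      simp only [t_def, Set.projIcc_of_le_left zero_le_one
        (div_nonpos_of_nonpos_of_nonneg (sub_nonpos.2 hx) hδ'.le)]
    simp only [this, AffineMap.lineMap_apply_zero]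
  · have : t x = 1 := by
      simp only [t_def, Set.projIcc_of_right_le zero_le_one
        ((one_le_div hδ').2 (le_sub_iff_add_le'.2 hx))]
    simp only [this, AffineMap.lineMap_apply_one]

lemma lipschitzWith_smul_of_eq_of_dist_lt {φ : X → ℝ} {u : X → F} {L : ℝ≥0} {r : ℝ}
    (hφ : LipschitzWith L φ) (hφ01 : ∀ x, φ x ∈ Set.Icc (0 : ℝ) 1) (hu : ∀ x, ‖u x‖ ≤ 1)
    (hLr : 2 ≤ L * r) (huu : ∀ x y, φ x ≠ 0 → φ y ≠ 0 → dist x y < r → u x = u y) :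
    LipschitzWith L fun x => φ x • u x := by
  have hle (x) : ‖φ x • u x‖ ≤ φ x := by
    rw [norm_smul, Real.norm_of_nonneg (hφ01 x).1]
    exact mul_le_of_le_one_right (hφ01 x).1 (hu x)
  refine LipschitzWith.of_dist_le_mul fun x y => ?_
  have hφxy : |φ x - φ y| ≤ L * dist x y := hφ.dist_le_mul x y
  rw [dist_eq_norm]
  rcases eq_or_ne (φ x) 0 with hx | hx
  · rw [hx, zero_smul, zero_sub, norm_neg]
    rw [hx, zero_sub, abs_neg] at hφxy
    exact (hle y).trans ((le_abs_self _).trans hφxy)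
  rcases eq_or_ne (φ y) 0 with hy | hy
  · rw [hy, zero_smul, sub_zero]
    rw [hy, sub_zero] at hφxy
    exact (hle x).trans ((le_abs_self _).trans hφxy)
  rcases lt_or_ge (dist x y) r with hxy | hxy
  · rw [huu x y hx hy hxy, ← sub_smul, norm_smul]
    exact (mul_le_of_le_one_right (norm_nonneg _) (hu y)).trans hφxy
  · calc ‖φ x • u x - φ y • u y‖ ≤ φ x + φ y := (norm_sub_le _ _).trans (add_le_add (hle x) (hle y))
      _ ≤ L * r := by linarith [(hφ01 x).2, (hφ01 y).2]
      _ ≤ L * dist x y := by gcongr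

end Lipschitz

section Extensor

variable {X E F : Type*} [MetricSpace X] [MetricSpace E] [MetricSpace F]

lemma IsLipschitzExtensor.of_retract {a b : ℝ≥0} {i : E → F} {ρ : F → E}
    (hF : IsLipschitzExtensor F X) (hi : LipschitzWith a i) (hρ : LipschitzWith b ρ)
    (hρi : Function.LeftInverse ρ i) : IsLipschitzExtensor E X := by
  obtain ⟨C, -, hC⟩ := hF
  refine ⟨b * C * a + 1, by positivity, fun K A f hf => ?_⟩
  obtain ⟨g, hg, hgf⟩ := hC (a * K) A (i ∘ f) (hi.comp hf)
  refine ⟨ρ ∘ g, (hρ.comp hg).weaken ?_, fun x => ?_⟩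
  · rw [add_mul, ← mul_assoc, ← mul_assoc]
    exact le_self_add
  · rw [Function.comp_apply, hgf, Function.comp_apply, hρi]

lemma IsLipschitzExtensor.exists_extension {S : Set F} (hS : IsLipschitzExtensor S X) :
    ∃ C : ℝ≥0, ∀ (K : ℝ≥0) (A : Set X) (f : X → F), LipschitzOnWith K f A → Set.MapsTo f A S →
      ∃ g : X → F, LipschitzWith (C * K) g ∧ (∀ x, g x ∈ S) ∧ Set.EqOn g f A := by
  obtain ⟨C, -, hC⟩ := hS
  refine ⟨C, fun K A f hf hfS => ?_⟩
  obtain ⟨g, hg, hgf⟩ := hC K A (hfS.restrict f A S) fun x y => hf x.2 y.2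
  exact ⟨fun x => g x, hg, fun x => (g x).2, fun x hx => congrArg Subtype.val (hgf ⟨x, hx⟩)⟩

lemma isLipschitzExtensor_of_forall_pos {S : Set F} (hS : S.Nonempty) (C : ℝ≥0)
    (h : ∀ K : ℝ≥0, 0 < K → ∀ (A : Set X) (f : X → F), LipschitzOnWith K f A →
      Set.MapsTo f A S → ∃ g : X → F, LipschitzWith (C * K) g ∧ (∀ x, g x ∈ S) ∧ Set.EqOn g f A) :
    IsLipschitzExtensor S X := by
  obtain ⟨s, hs⟩ := hS
  refine ⟨C + 1, by positivity, fun K A f hf => ?_⟩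
  rcases eq_zero_or_pos K with rfl | hK
  · rcases A.eq_empty_or_nonempty with rfl | ⟨a, ha⟩
    · exact ⟨fun _ => ⟨s, hs⟩, LipschitzWith.const' _, fun x => x.2.elim⟩
    · refine ⟨fun _ => f ⟨a, ha⟩, LipschitzWith.const' _, fun x => dist_le_zero.1 ?_⟩
      simpa only [NNReal.coe_zero, zero_mul] using hf.dist_le_mul ⟨a, ha⟩ x
  · set f' : X → F := Function.extend Subtype.val (fun a => (f a : F)) fun _ => s
    have hf' (a : A) : f' a = f a := Subtype.val_injective.extend_apply _ _ a
    obtain ⟨g, hg, hgS, hgf⟩ := h K hK A f'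
      (fun x hx y hy => by rw [hf' ⟨x, hx⟩, hf' ⟨y, hy⟩]; exact hf ⟨x, hx⟩ ⟨y, hy⟩)
      (fun x hx => by rw [hf' ⟨x, hx⟩]; exact Subtype.prop _)
    refine ⟨fun x => ⟨g x, hgS x⟩, fun x y => (hg.weaken ?_) x y, fun a => Subtype.ext ?_⟩
    · rw [add_mul]
      exact le_self_add
    · rw [← hf' a]
      exact hgf a.2

end Extensor

section Simplex

variable {ι : Type*} [Fintype ι]

/-- The central projection of the nonnegative orthant onto the standard simplex. -/
noncomputable def sumNormalize (v : ι → ℝ) : ι → ℝ := (∑ i, v i)⁻¹ • v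

lemma sumNormalize_mem_stdSimplex {v : ι → ℝ} (hv : 0 ≤ v) (hsum : 0 < ∑ i, v i) :
    sumNormalize v ∈ stdSimplex ℝ ι := by
  refine ⟨fun i => mul_nonneg (inv_nonneg.2 hsum.le) (hv i), ?_⟩
  simp only [sumNormalize, Pi.smul_apply, smul_eq_mul, ← Finset.mul_sum]
  exact inv_mul_cancel₀ hsum.ne'

lemma sumNormalize_eq_self {v : ι → ℝ} (hsum : ∑ i, v i = 1) : sumNormalize v = v := by
  rw [sumNormalize, hsum, inv_one, one_smul]

lemma norm_le_one_of_mem_stdSimplex {v : ι → ℝ} (hv : v ∈ stdSimplex ℝ ι) : ‖v‖ ≤ 1 :=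
  mem_closedBall_zero_iff.1 (stdSimplex_subset_closedBall hv)

lemma dist_le_one_of_mem_stdSimplex {v w : ι → ℝ} (hv : v ∈ stdSimplex ℝ ι)
    (hw : w ∈ stdSimplex ℝ ι) : dist v w ≤ 1 := by
  refine (dist_pi_le_iff zero_le_one).2 fun i => ?_
  have hvi := mem_Icc_of_mem_stdSimplex hv i
  have hwi := mem_Icc_of_mem_stdSimplex hw i
  exact abs_sub_le_iff.2 ⟨by linarith [hvi.2, hwi.1], by linarith [hvi.1, hwi.2]⟩

lemma lipschitzWith_sum_apply :
    LipschitzWith (Fintype.card ι) fun v : ι → ℝ => ∑ i, v i := by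
  simpa only [Finset.card_univ, mul_one] using
    lipschitzWith_finset_sum (f := fun i (v : ι → ℝ) => v i) Finset.univ
      fun i _ => LipschitzWith.eval i

lemma lipschitzOnWith_sumNormalize (ε : ℝ≥0) (hε : 0 < ε) :
    LipschitzOnWith ((1 + Fintype.card ι) / ε) (sumNormalize (ι := ι))
      {v | 0 ≤ v ∧ (ε : ℝ) ≤ ∑ i, v i} := by
  refine LipschitzOnWith.of_dist_le_mul fun v hv w hw => ?_
  set s := ∑ i, v i
  set t := ∑ i, w i
  have hs : 0 < s := (NNReal.coe_pos.2 hε).trans_le hv.2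
  have ht : 0 < t := (NNReal.coe_pos.2 hε).trans_le hw.2
  have split : sumNormalize v - sumNormalize w = s⁻¹ • ((v - w) + (t - s) • (t⁻¹ • w)) := by
    ext i
    simp only [sumNormalize, Pi.sub_apply, Pi.smul_apply, Pi.add_apply, smul_eq_mul]
    change s⁻¹ * v i - t⁻¹ * w i = s⁻¹ * (v i - w i + (t - s) * (t⁻¹ * w i))
    field_simp
    ring
  have hts : ‖(t - s) • (t⁻¹ • w)‖ ≤ Fintype.card ι * dist v w := by
    rw [norm_smul, ← dist_eq_norm, dist_comm]
    exact (mul_le_of_le_one_right dist_nonneg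
      (norm_le_one_of_mem_stdSimplex (sumNormalize_mem_stdSimplex hw.1 ht))).trans
      (lipschitzWith_sum_apply.dist_le_mul v w)
  rw [dist_eq_norm, split, norm_smul, norm_inv, Real.norm_of_nonneg hs.le]
  calc s⁻¹ * ‖(v - w) + (t - s) • (t⁻¹ • w)‖
      ≤ (ε : ℝ)⁻¹ * (dist v w + Fintype.card ι * dist v w) := by
        gcongr
        · exact hv.2
        · exact (norm_add_le _ _).trans (by rw [dist_eq_norm v w] at *; gcongr)
    _ = ((1 + Fintype.card ι) / ε : ℝ≥0) * dist v w := by push_cast; ring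

lemma exists_lipschitzWith_retraction_stdSimplex (ι : Type*) [Fintype ι] [Nonempty ι] :
    ∃ (C : ℝ≥0) (ρ : (ι → ℝ) → ι → ℝ), LipschitzWith C ρ ∧ (∀ y, ρ y ∈ stdSimplex ℝ ι) ∧
      ∀ y ∈ stdSimplex ℝ ι, ρ y = y := by
  -- Clip the coordinates at `0`, top up a coordinate sum below `1`, and normalize.
  set deficit : (ι → ℝ) → ℝ := fun y => max (1 - ∑ j, max (y j) 0) 0
  set lift : (ι → ℝ) → ι → ℝ := fun y i => max (y i) 0 + deficit y
  have lift_nonneg (y) : 0 ≤ lift y := fun i => by positivity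
  have one_le_sum_lift (y) : ((1 : ℝ≥0) : ℝ) ≤ ∑ i, lift y i := by
    have hcard : deficit y ≤ Fintype.card ι * deficit y :=
      le_mul_of_one_le_left (le_max_right _ _) (Nat.one_le_cast.2 Fintype.card_pos)
    rw [Finset.sum_add_distrib, Finset.sum_const, Finset.card_univ, nsmul_eq_mul, NNReal.coe_one]
    linarith [le_max_left (1 - ∑ j, max (y j) 0) 0]
  have hclip (i) : LipschitzWith 1 fun y : ι → ℝ => max (y i) 0 :=
    (LipschitzWith.eval i).max_const 0
  have hdeficit : LipschitzWith (Fintype.card ι) deficit := by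
    simpa only [zero_add, mul_one] using!
      ((LipschitzWith.const (1 : ℝ)).sub
        (lipschitzWith_sum_apply.comp (lipschitzWith_pi hclip))).max_const 0
  have hlift : LipschitzWith (1 + Fintype.card ι) lift :=
    lipschitzWith_pi fun i => (hclip i).add hdeficit
  refine ⟨(1 + Fintype.card ι) / 1 * (1 + Fintype.card ι), fun y => sumNormalize (lift y), ?_,
    fun y => ?_, fun y hy => ?_⟩
  · exact lipschitzOnWith_univ.1 <| (lipschitzOnWith_sumNormalize 1 one_pos).comp
      hlift.lipschitzOnWith fun y _ => ⟨lift_nonneg y, one_le_sum_lift y⟩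
  · exact sumNormalize_mem_stdSimplex (lift_nonneg _) (one_pos.trans_le (one_le_sum_lift _))
  · have : lift y = y := by
      ext i
      simp only [lift, deficit, max_eq_left (hy.1 _), hy.2, sub_self, max_self, add_zero]
    simp only [this, sumNormalize_eq_self hy.2]

lemma isLipschitzExtensor_stdSimplex [Nonempty ι] {X : Type*} [MetricSpace X] :
    IsLipschitzExtensor (stdSimplex ℝ ι) X := by
  classical
  obtain ⟨C, ρ, hρ, hρΔ, hρ_eq⟩ := exists_lipschitzWith_retraction_stdSimplex ι
  refine isLipschitzExtensor_of_forall_pos ⟨_, single_mem_stdSimplex ℝ (Classical.arbitrary ι)⟩ C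
    fun K _ A f hf hfΔ => ?_
  obtain ⟨g, hg, hfg⟩ := LipschitzOnWith.extend_pi hf
  exact ⟨ρ ∘ g, hρ.comp hg, fun x => hρΔ _, fun x hx => by
    rw [Function.comp_apply, ← hfg hx, hρ_eq _ (hfΔ hx)]⟩

end Simplex

section MinRatio

variable {ι : Type*}

/-- The points of the standard simplex having a vanishing coordinate, with the sup metric. -/
def simplexBoundary (ι : Type*) [Fintype ι] : Set (ι → ℝ) :=
  {x | x ∈ stdSimplex ℝ ι ∧ ∃ i, x i = 0}

/-- The least ratio `y i / q i`. For `q` in the interior of the standard simplex this is the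
function on the simplex which is `0` on the boundary, `1` at `q` and affine on segments from `q`. -/
noncomputable def minRatio (q y : ι → ℝ) : ℝ := ⨅ i, y i / q i

/-- The radial projection of the standard simplex from an interior point `q` onto its boundary. -/
noncomputable def radialProj [Fintype ι] (q y : ι → ℝ) : ι → ℝ :=
  sumNormalize (y - minRatio q y • q)

lemma simplexBoundary_nonempty [Fintype ι] [Nontrivial ι] : (simplexBoundary ι).Nonempty := by
  classical
  obtain ⟨i, j, hij⟩ := exists_pair_ne ι
  exact ⟨Pi.single i 1, single_mem_stdSimplex ℝ i, j, Pi.single_eq_of_ne' hij 1⟩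

lemma minRatio_nonneg {q y : ι → ℝ} (hq : ∀ i, 0 < q i) (hy : 0 ≤ y) : 0 ≤ minRatio q y :=
  Real.iInf_nonneg fun i => div_nonneg (hy i) (hq i).le

section Finite

variable [Finite ι] {q y : ι → ℝ}

lemma minRatio_le (q y : ι → ℝ) (i : ι) : minRatio q y ≤ y i / q i :=
  ciInf_le (Set.finite_range _).bddBelow i

lemma minRatio_mul_le (hq : ∀ i, 0 < q i) (y : ι → ℝ) (i : ι) :
    minRatio q y * q i ≤ y i :=
  (le_div_iff₀ (hq i)).1 (minRatio_le q y i)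

lemma sub_minRatio_smul_nonneg (hq : ∀ i, 0 < q i) (y : ι → ℝ) : 0 ≤ y - minRatio q y • q :=
  fun i => sub_nonneg.2 (minRatio_mul_le hq y i)

lemma minRatio_eq_of_le (hq : ∀ i, 0 < q i) {a : ℝ} (h : ∀ i, a * q i ≤ y i)
    (h' : ∃ i, y i = a * q i) : minRatio q y = a := by
  obtain ⟨i, hi⟩ := h'
  have : Nonempty ι := ⟨i⟩
  refine le_antisymm ((minRatio_le q y i).trans_eq ?_)
    (le_ciInf fun j => (le_div_iff₀ (hq j)).2 (h j))
  rw [hi, mul_div_cancel_right₀ _ (hq i).ne']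

variable [Nonempty ι]

lemma exists_eq_minRatio_mul (hq : ∀ i, 0 < q i) (y : ι → ℝ) : ∃ i, y i = minRatio q y * q i := by
  obtain ⟨i, hi⟩ := exists_eq_ciInf_of_finite (f := fun i => y i / q i)
  exact ⟨i, by rw [minRatio, ← hi, div_mul_cancel₀ _ (hq i).ne']⟩

lemma minRatio_add_smul (hq : ∀ i, 0 < q i) (y : ι → ℝ) (a : ℝ) :
    minRatio q (y + a • q) = minRatio q y + a := by
  refine minRatio_eq_of_le hq (fun j => ?_) ((exists_eq_minRatio_mul hq y).imp fun i hi => ?_) <;>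
    simp only [Pi.add_apply, Pi.smul_apply, smul_eq_mul, add_mul]
  · exact add_le_add_left (minRatio_mul_le hq y j) _
  · rw [← hi]

end Finite

variable [Fintype ι] {q y : ι → ℝ}

lemma minRatio_eq_zero (hq : ∀ i, 0 < q i) (hy : y ∈ simplexBoundary ι) : minRatio q y = 0 :=
  minRatio_eq_of_le hq (by simpa only [zero_mul] using hy.1.1)
    (by simpa only [zero_mul] using hy.2)

lemma minRatio_le_one (hq : ∀ i, 0 < q i) (hq1 : ∑ i, q i = 1) (hy : y ∈ stdSimplex ℝ ι) :
    minRatio q y ≤ 1 :=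
  calc minRatio q y = ∑ i, minRatio q y * q i := by rw [← Finset.mul_sum, hq1, mul_one]
    _ ≤ ∑ i, y i := Finset.sum_le_sum fun i _ => minRatio_mul_le hq y i
    _ = 1 := hy.2

lemma minRatio_lt_one (hq : ∀ i, 0 < q i) (hq1 : ∑ i, q i = 1) (hy : y ∈ stdSimplex ℝ ι)
    (hne : y ≠ q) : minRatio q y < 1 := by
  refine lt_of_le_of_ne (minRatio_le_one hq hq1 hy) fun h => hne ?_
  have hle : ∀ i ∈ Finset.univ, q i ≤ y i := fun i _ => by
    simpa only [h, one_mul] using minRatio_mul_le hq y i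
  exact funext fun i => ((Finset.sum_eq_sum_iff_of_le hle).1 (hq1.trans hy.2.symm) i
    (Finset.mem_univ i)).symm

lemma sum_sub_smul_eq_one_sub (hq1 : ∑ i, q i = 1) (hy1 : ∑ i, y i = 1) (a : ℝ) :
    ∑ i, (y - a • q) i = 1 - a := by
  simp only [Pi.sub_apply, Pi.smul_apply, smul_eq_mul, Finset.sum_sub_distrib, ← Finset.mul_sum,
    hq1, hy1, mul_one]

lemma radialProj_eq_self (hq : ∀ i, 0 < q i) (hy : y ∈ simplexBoundary ι) :
    radialProj q y = y := by
  rw [radialProj, minRatio_eq_zero hq hy, zero_smul, sub_zero, sumNormalize_eq_self hy.1.2]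

variable [Nonempty ι]

lemma lipschitzWith_minRatio {κ : ℝ≥0} (hκ : 0 < κ) (hq : ∀ i, κ ≤ q i) :
    LipschitzWith κ⁻¹ (minRatio q) := by
  refine LipschitzWith.of_le_add_mul κ⁻¹ fun y z => ?_
  have hq0 (i) : 0 < q i := (NNReal.coe_pos.2 hκ).trans_le (hq i)
  obtain ⟨i, hi⟩ := exists_eq_minRatio_mul hq0 z
  calc minRatio q y ≤ y i / q i := minRatio_le q y i
    _ = minRatio q z + (q i)⁻¹ * (y i - z i) := by
        rw [hi]
        field_simp [(hq0 i).ne']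
        ring
    _ ≤ minRatio q z + (q i)⁻¹ * dist y z := by
        gcongr
        · exact inv_nonneg.2 (hq0 i).le
        · exact (le_abs_self _).trans (dist_le_pi_dist y z i)
    _ ≤ minRatio q z + (κ⁻¹ : ℝ≥0) * dist y z := by
        rw [NNReal.coe_inv]
        gcongr
        exact hq i

lemma radialProj_mem_simplexBoundary (hq : ∀ i, 0 < q i) (hq1 : ∑ i, q i = 1)
    (hy1 : ∑ i, y i = 1) (h : minRatio q y < 1) : radialProj q y ∈ simplexBoundary ι := by
  refine ⟨sumNormalize_mem_stdSimplex (sub_minRatio_smul_nonneg hq y) ?_,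
    (exists_eq_minRatio_mul hq y).imp fun i hi => ?_⟩
  · rw [sum_sub_smul_eq_one_sub hq1 hy1]
    exact sub_pos.2 h
  · simp only [radialProj, sumNormalize, Pi.smul_apply, Pi.sub_apply, smul_eq_mul, ← hi, sub_self,
      mul_zero]

lemma lipschitzOnWith_radialProj {κ ε : ℝ≥0} (hκ : 0 < κ) (hq : ∀ i, κ ≤ q i)
    (hq1 : ∑ i, q i = 1) (hε : 0 < ε) :
    LipschitzOnWith ((1 + Fintype.card ι) / ε * (1 + κ⁻¹)) (radialProj q)
      {y | ∑ i, y i = 1 ∧ minRatio q y ≤ 1 - ε} := by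
  have hq0 (i) : 0 < q i := (NNReal.coe_pos.2 hκ).trans_le (hq i)
  have hqΔ : q ∈ stdSimplex ℝ ι := ⟨fun i => (hq0 i).le, hq1⟩
  have shift : LipschitzWith κ⁻¹ fun y => minRatio q y • q :=
    lipschitzWith_smul_const_of_norm_le_one (lipschitzWith_minRatio hκ hq)
      (norm_le_one_of_mem_stdSimplex hqΔ)
  refine (lipschitzOnWith_sumNormalize ε hε).comp (LipschitzWith.id.sub shift).lipschitzOnWith
    fun y hy => ⟨sub_minRatio_smul_nonneg hq0 y, ?_⟩
  rw [sum_sub_smul_eq_one_sub hq1 hy.1]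
  linarith [hy.2]

end MinRatio

section Sphere

variable {X : Type*} [MetricSpace X] {n : ℕ} {p : ℝ≥0∞} [Fact (1 ≤ p)]

lemma isLipschitzExtensor_simplexSphere_iff :
    IsLipschitzExtensor (simplexSphere p n) X ↔
      IsLipschitzExtensor (simplexBoundary (Fin (n + 2))) X := by
  let toSup : simplexSphere p n → simplexBoundary (Fin (n + 2)) := fun x => ⟨x.1.ofLp, x.2⟩
  let ofSup : simplexBoundary (Fin (n + 2)) → simplexSphere p n := fun x => ⟨WithLp.toLp p x.1, x.2⟩
  have toSup_lip : LipschitzWith 1 toSup := fun x y => PiLp.lipschitzWith_ofLp p _ x.1 y.1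
  have ofSup_lip : LipschitzWith _ ofSup := fun x y => PiLp.lipschitzWith_toLp p _ x.1 y.1
  exact ⟨fun h => h.of_retract ofSup_lip toSup_lip fun _ => rfl,
    fun h => h.of_retract toSup_lip ofSup_lip fun _ => rfl⟩

end Sphere

section Gap

variable {ι : Type*}

/-- The coordinates of `v` indexed by `S` exceed all the others by at least `η`. -/
def HasGap (η : ℝ) (S : Finset ι) (v : ι → ℝ) : Prop := ∀ i ∈ S, ∀ j ∉ S, v j + η ≤ v i

variable {η : ℝ} {S T : Finset ι} {v w : ι → ℝ}

lemma HasGap.pos [Fintype ι] (h : HasGap η S v) (hη : 0 < η) (hv : 0 ≤ v)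
    (hS : S ≠ Finset.univ) {i : ι} (hi : i ∈ S) : 0 < v i := by
  obtain ⟨j, hj⟩ : ∃ j, j ∉ S := by
    simpa only [ne_eq, Finset.eq_univ_iff_forall, not_forall] using hS
  linarith [h i hi j hj, show 0 ≤ v j from hv j]

lemma HasGap.eq_of_dist_lt [Fintype ι] (hv : HasGap η S v) (hw : HasGap η T w)
    (hcard : S.card = T.card) (hvw : dist v w < η) : S = T := by
  by_contra hne
  obtain ⟨i, hiS, hiT⟩ : ∃ i ∈ S, i ∉ T :=
    Finset.not_subset.1 fun h => hne (Finset.eq_of_subset_of_card_le h hcard.ge)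
  obtain ⟨j, hjT, hjS⟩ : ∃ j ∈ T, j ∉ S :=
    Finset.not_subset.1 fun h => hne (Finset.eq_of_subset_of_card_le h hcard.le).symm
  have hi := abs_lt.1 ((dist_le_pi_dist v w i).trans_lt hvw)
  have hj := abs_lt.1 ((dist_le_pi_dist v w j).trans_lt hvw)
  linarith [hv i hiS j hjS, hw j hjT i hiT]

lemma exists_hasGap_of_mem_simplexBoundary [Fintype ι] (hv : v ∈ simplexBoundary ι) :
    ∃ S : Finset ι, S.Nonempty ∧ S ≠ Finset.univ ∧ HasGap (1 / (Fintype.card ι : ℝ) ^ 2) S v := by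
  classical
  obtain ⟨hvΔ, i₀, hi₀⟩ := hv
  set N := Fintype.card ι with N_def
  have hN : (0 : ℝ) < N := Nat.cast_pos.2 (Fintype.card_pos_iff.2 ⟨i₀⟩)
  -- The `N` coordinates miss one of the `N + 1` levels `0, …, N` in units of `1 / N ^ 2`.
  set level : ι → ℕ := fun i => ⌈N ^ 2 * v i⌉₊
  obtain ⟨k, hkN, hk⟩ : ∃ k ∈ Finset.range (N + 1), k ∉ Finset.univ.image level :=
    Finset.exists_mem_notMem_of_card_lt_card <| Finset.card_image_le.trans_lt <| by
      rw [Finset.card_univ, Finset.card_range]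
      exact Nat.lt_succ_self N
  have hkN' : (k : ℝ) ≤ N := Nat.cast_le.2 (Finset.mem_range_succ_iff.1 hkN)
  have hhigh {i} (hi : k < level i) : (k : ℝ) < N ^ 2 * v i := Nat.lt_ceil.1 hi
  have hlow {i} (hi : ¬k < level i) : (N : ℝ) ^ 2 * v i + 1 ≤ k := by
    have hlt : level i < k := lt_of_le_of_ne (not_lt.1 hi) fun h =>
      hk (Finset.mem_image.2 ⟨i, Finset.mem_univ i, h⟩)
    have hle : (level i : ℝ) + 1 ≤ k := by exact_mod_cast hlt
    linarith [Nat.le_ceil ((N : ℝ) ^ 2 * v i)]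
  refine ⟨Finset.univ.filter fun i => k < level i, ?_, fun huniv => ?_, fun i hi j hj => ?_⟩
  · by_contra hempty
    have hsum : ∑ i, ((N : ℝ) ^ 2 * v i + 1) ≤ ∑ _i : ι, (N : ℝ) :=
      Finset.sum_le_sum fun i _ => (hlow fun hi => hempty ⟨i, by simpa using hi⟩).trans hkN'
    rw [Finset.sum_add_distrib, ← Finset.mul_sum, hvΔ.2] at hsum
    simp only [Finset.sum_const, Finset.card_univ, ← N_def, nsmul_eq_mul] at hsum
    nlinarith
  · have hi₀' := hhigh (Finset.mem_filter.1 (Finset.eq_univ_iff_forall.1 huniv i₀)).2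
    rw [hi₀, mul_zero] at hi₀'
    exact absurd hi₀' (not_lt.2 k.cast_nonneg)
  · have hi' := hhigh (Finset.mem_filter.1 hi).2
    have hj' := hlow fun h => hj (Finset.mem_filter.2 ⟨Finset.mem_univ j, h⟩)
    have hstep : (N : ℝ) ^ 2 * (v j + 1 / N ^ 2) ≤ N ^ 2 * v i := by
      rw [mul_add, mul_one_div_cancel (by positivity)]
      linarith
    exact le_of_mul_le_mul_left hstep (by positivity)

end Gap

section Covers

variable {X : Type*} [MetricSpace X]

lemma NagataDimLE.mono {m n : ℕ} (h : NagataDimLE X m) (hmn : m ≤ n) : NagataDimLE X n := by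
  obtain ⟨C, hC, H⟩ := h
  refine ⟨C, hC, fun r hr => ?_⟩
  obtain ⟨𝒰, hcov, hdisj, hdiam⟩ := H r hr
  refine ⟨fun i => if h : i.1 < m + 1 then 𝒰 ⟨i, h⟩ else ∅, fun x => ?_, fun i => ?_, fun i => ?_⟩
  · obtain ⟨i, hi⟩ := hcov x
    exact ⟨⟨i, by omega⟩, by simpa only [i.2, dite_true] using hi⟩
  · dsimp only
    split_ifs with h
    · exact hdisj ⟨i, h⟩
    · exact fun _ h => h.elim
  · dsimp only
    split_ifs with h
    · exact hdiam ⟨i, h⟩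
    · exact fun _ h => h.elim

lemma RDisjoint.exists_selection {r : ℝ} {𝒰 : Set (Set X)} (h𝒰 : RDisjoint (3 * r) 𝒰) :
    ∃ b : X → X,
      (∀ x ∈ Metric.thickening r (⋃₀ 𝒰), ∃ U ∈ 𝒰, x ∈ Metric.thickening r U ∧ b x ∈ U) ∧
      ∀ x ∈ Metric.thickening r (⋃₀ 𝒰), ∀ y ∈ Metric.thickening r (⋃₀ 𝒰),
        dist x y < r → b x = b y := by
  classical
  have hmember (x) (hx : x ∈ Metric.thickening r (⋃₀ 𝒰)) : ∃ U ∈ 𝒰, x ∈ Metric.thickening r U := by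
    obtain ⟨z, ⟨U, hU, hzU⟩, hxz⟩ := Metric.mem_thickening_iff.1 hx
    exact ⟨U, hU, Metric.mem_thickening_iff.2 ⟨z, hzU, hxz⟩⟩
  choose! U hU hxU using hmember
  have hne (x) (hx : x ∈ Metric.thickening r (⋃₀ 𝒰)) : (U x).Nonempty :=
    (Metric.mem_thickening_iff.1 (hxU x hx)).imp fun _ h => h.1
  have hUeq (x) (hx : x ∈ Metric.thickening r (⋃₀ 𝒰)) (y) (hy : y ∈ Metric.thickening r (⋃₀ 𝒰))
      (hxy : dist x y < r) : U x = U y := by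
    by_contra hUne
    obtain ⟨x', hx', hxx'⟩ := Metric.mem_thickening_iff.1 (hxU x hx)
    obtain ⟨y', hy', hyy'⟩ := Metric.mem_thickening_iff.1 (hxU y hy)
    have := h𝒰 _ (hU x hx) _ (hU y hy) hUne x' hx' y' hy'
    linarith [dist_triangle4 x' x y y', dist_comm x' x]
  refine ⟨fun x => if h : (U x).Nonempty then h.some else x, fun x hx => ?_,
    fun x hx y hy hxy => ?_⟩
  · simp only [hne x hx, dite_true]
    exact ⟨U x, hU x hx, hxU x hx, (hne x hx).some_mem⟩
  · simp only [hne y hy, dite_true, hUeq x hx y hy hxy]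

lemma exists_lipschitzWith_partition {ι : Type*} [Fintype ι] {V : ι → Set X}
    (hV : ∀ x, ∃ i, x ∈ V i) {r : ℝ≥0} (hr : 0 < r) :
    ∃ w : X → ι → ℝ, LipschitzWith ((1 + Fintype.card ι) / r) w ∧
      (∀ x, w x ∈ stdSimplex ℝ ι) ∧ ∀ x i, w x i ≠ 0 → x ∈ Metric.thickening r (V i) := by
  have hr' : (0 : ℝ) < r := hr
  set ω : X → ι → ℝ := fun x i => thickenedIndicator hr' (V i) x
  have hω0 (x) : 0 ≤ ω x := fun i => NNReal.coe_nonneg _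
  have hω1 (x) : ((1 : ℝ≥0) : ℝ) ≤ ∑ i, ω x i := by
    obtain ⟨i, hx⟩ := hV x
    rw [← thickenedIndicator_one hr' _ hx]
    exact Finset.single_le_sum (fun j _ => hω0 x j) (Finset.mem_univ i)
  have hω : LipschitzWith r⁻¹ ω := by
    refine lipschitzWith_pi fun i => ?_
    simpa only [Real.toNNReal_coe] using! lipschitzWith_thickenedIndicator hr' (V i)
  refine ⟨fun x => sumNormalize (ω x), ?_, fun x => ?_, fun x i hx => ?_⟩
  · rw [← div_one (1 + (Fintype.card ι : ℝ≥0)), div_eq_mul_inv _ r]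
    exact lipschitzOnWith_univ.1 <| (lipschitzOnWith_sumNormalize 1 one_pos).comp
      hω.lipschitzOnWith fun x _ => ⟨hω0 x, hω1 x⟩
  · exact sumNormalize_mem_stdSimplex (hω0 x) (one_pos.trans_le (hω1 x))
  · contrapose! hx
    have : ω x i = 0 := by simp only [ω, thickenedIndicator_zero hr' _ hx, NNReal.coe_zero]
    rw [sumNormalize, Pi.smul_apply, this, smul_zero]

/-- `b i x` is a base point of the member of the `i`-th family that lies near `x`. -/
lemma NagataDimLE.exists_partition {n : ℕ} (h : NagataDimLE X n) :
    ∃ C : ℝ≥0, 2 ≤ C ∧ ∀ r : ℝ≥0, 0 < r → ∃ (w : X → Fin (n + 1) → ℝ) (b : Fin (n + 1) → X → X),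
      LipschitzWith (C / r) w ∧ (∀ x, w x ∈ stdSimplex ℝ (Fin (n + 1))) ∧
      (∀ i x, w x i ≠ 0 → dist x (b i x) ≤ C * r) ∧
      ∀ i x y, w x i ≠ 0 → w y i ≠ 0 → dist x y < r → b i x = b i y := by
  obtain ⟨C, hC, H⟩ := h
  refine ⟨1 + (n + 1 : ℕ) + 3 * C.toNNReal, ?_, fun r hr => ?_⟩
  · rw [← one_add_one_eq_two]
    exact le_add_right (by gcongr; exact Nat.one_le_cast.2 n.succ_pos)
  obtain ⟨𝒰, hcov, hdisj, hdiam⟩ := H (3 * r) (by positivity)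
  choose b hbU hbeq using fun i => (hdisj i).exists_selection
  obtain ⟨w, hw, hwΔ, hw_mem⟩ := exists_lipschitzWith_partition (V := fun i => ⋃₀ 𝒰 i)
    (fun x => (hcov x).imp fun i ⟨U, hU, hx⟩ => ⟨U, hU, hx⟩) hr
  refine ⟨w, b, hw.weaken ?_, hwΔ, fun i x hx => ?_, fun i x y hx hy =>
    hbeq i x (hw_mem x i hx) y (hw_mem y i hy)⟩
  · rw [Fintype.card_fin]
    exact div_le_div_of_nonneg_right le_self_add r.2
  · obtain ⟨U, hU, hxU, hbx⟩ := hbU i x (hw_mem x i hx)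
    obtain ⟨z, hz, hxz⟩ := Metric.mem_thickening_iff.1 hxU
    calc dist x (b i x) ≤ dist x z + dist z (b i x) := dist_triangle _ _ _
      _ ≤ 1 * r + C * (3 * r) := by
        rw [one_mul]
        exact add_le_add hxz.le (hdiam i U hU z hz _ hbx)
      _ ≤ (1 + (n + 1 : ℕ) + 3 * C.toNNReal : ℝ≥0) * r := by
        push_cast [Real.coe_toNNReal C hC.le]
        nlinarith [mul_nonneg n.cast_nonneg (α := ℝ) r.coe_nonneg]

/-- The points `x` for which the coordinates of `v x` in `S` are positive and separated by a gap
`η` from the others, and for which `b i x = c i` for each `i ∈ S`. These are the members of the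
covers showing that the dimension drops; the `c i` are base points, and locate the cell. -/
def gapCell {ι : Type*} (η : ℝ) (v : X → ι → ℝ) (b : ι → X → X) (S : Finset ι) (c : ι → X) :
    Set X :=
  {x | HasGap η S (v x) ∧ (∀ i ∈ S, 0 < v x i) ∧ ∀ i ∈ S, b i x = c i}

lemma exists_rDisjoint_cover_of_simplexBoundary {n : ℕ} {v : X → Fin (n + 2) → ℝ}
    {b : Fin (n + 2) → X → X} {r R : ℝ} (hv : ∀ x, v x ∈ simplexBoundary (Fin (n + 2)))
    (hv_dist : ∀ x y, dist x y < r → dist (v x) (v y) < 1 / ((n + 2 : ℕ) : ℝ) ^ 2)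
    (hb : ∀ i x, 0 < v x i → dist x (b i x) ≤ R)
    (hb_eq : ∀ i x y, 0 < v x i → 0 < v y i → dist x y < r → b i x = b i y) :
    ∃ 𝒰 : Fin (n + 1) → Set (Set X), (∀ x, ∃ i, ∃ U ∈ 𝒰 i, x ∈ U) ∧ (∀ i, RDisjoint r (𝒰 i)) ∧
      ∀ i, ∀ U ∈ 𝒰 i, ∀ x ∈ U, ∀ y ∈ U, dist x y ≤ 2 * R := by
  set η : ℝ := 1 / ((n + 2 : ℕ) : ℝ) ^ 2
  refine ⟨fun k => {U | ∃ S c, S.card = k.1 + 1 ∧ U = gapCell η v b S c}, fun x => ?_, fun k => ?_,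
    fun k => ?_⟩
  · obtain ⟨S, hSne, hSuniv, hgap⟩ := exists_hasGap_of_mem_simplexBoundary (hv x)
    rw [Fintype.card_fin] at hgap
    have hSpos := hSne.card_pos
    have hSlt := (Finset.card_lt_iff_ne_univ S).2 hSuniv
    rw [Fintype.card_fin] at hSlt
    exact ⟨⟨S.card - 1, by omega⟩, gapCell η v b S fun i => b i x,
      ⟨S, _, (Nat.sub_add_cancel hSpos).symm, rfl⟩, hgap,
      fun i hi => hgap.pos (by positivity) (hv x).1.1 hSuniv hi, fun i _ => rfl⟩
  · rintro _ ⟨S, c, hS, rfl⟩ _ ⟨T, c', hT, rfl⟩ hne x ⟨hx_gap, hx_pos, hxc⟩ y ⟨hy_gap, hy_pos, hyc⟩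
    by_contra! hxy
    obtain rfl : S = T := hx_gap.eq_of_dist_lt hy_gap (hS.trans hT.symm) (hv_dist x y hxy)
    have hcc' (i) (hi : i ∈ S) : c i = c' i := by
      rw [← hxc i hi, ← hyc i hi, hb_eq i x y (hx_pos i hi) (hy_pos i hi) hxy]
    refine hne (Set.ext fun z => and_congr_right fun _ => and_congr_right fun _ => ?_)
    exact forall₂_congr fun i hi => by rw [hcc' i hi]
  · rintro _ ⟨S, c, hS, rfl⟩ x ⟨-, hx_pos, hxc⟩ y ⟨-, hy_pos, hyc⟩
    obtain ⟨i, hi⟩ : S.Nonempty := Finset.card_pos.1 (by omega)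
    calc dist x y ≤ dist x (c i) + dist y (c i) := dist_triangle_right x y (c i)
      _ ≤ R + R := by
        gcongr
        · exact hxc i hi ▸ hb i x (hx_pos i hi)
        · exact hyc i hi ▸ hb i y (hy_pos i hi)
      _ = 2 * R := (two_mul R).symm

lemma NagataDimLE.of_succ {n : ℕ} (h : NagataDimLE X (n + 1))
    (hE : IsLipschitzExtensor (simplexBoundary (Fin (n + 2))) X) : NagataDimLE X n := by
  obtain ⟨C, hC2, H⟩ := h.exists_partition
  obtain ⟨D, HD⟩ := hE.exists_extension
  have hC : 0 < C := two_pos.trans_le hC2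
  set η : ℝ≥0 := 1 / (n + 2 : ℕ) ^ 2
  have hη : 0 < η := by positivity
  set κ : ℝ≥0 := 1 + D * C / η
  have hκ : 1 ≤ κ := le_self_add
  refine ⟨2 * (C * κ), mul_pos two_pos (mul_pos hC (one_pos.trans_le hκ)), fun r hr => ?_⟩
  lift r to ℝ≥0 using hr.le
  have hκr : 0 < κ * r := mul_pos (one_pos.trans_le hκ) hr
  obtain ⟨w, b, hw, hwΔ, hb, hb_eq⟩ := H (κ * r) hκr
  obtain ⟨v, hv, hvS, hvw⟩ := HD _ {x | w x ∈ simplexBoundary _} w hw.lipschitzOnWith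
    fun x hx => hx
  have w_ne {i x} (hx : 0 < v x i) : w x i ≠ 0 := fun hwx =>
    hx.ne' ((congrFun (hvw ⟨hwΔ x, i, hwx⟩) i).trans hwx)
  have v_dist (x y) (hxy : dist x y < r) : dist (v x) (v y) < η := by
    calc dist (v x) (v y) ≤ (D * (C / (κ * r)) : ℝ≥0) * dist x y := hv.dist_le_mul x y
      _ ≤ (D * (C / (κ * r)) : ℝ≥0) * r := by gcongr
      _ = (D * C / κ : ℝ≥0) := by
        push_cast
        field_simp
      _ < η := by
        rw [NNReal.coe_lt_coe, div_lt_iff₀ (by positivity), mul_add, mul_div_cancel₀ _ hη.ne']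
        exact lt_add_of_pos_left _ (by rwa [mul_one])
  rw [mul_assoc, mul_assoc]
  refine exists_rDisjoint_cover_of_simplexBoundary hvS (fun x y hxy => ?_)
    (fun i x hx => hb i x (w_ne hx)) fun i x y hx hy hxy =>
      hb_eq i x y (w_ne hx) (w_ne hy) (hxy.trans_le ?_)
  · simpa [η] using v_dist x y hxy
  · exact le_mul_of_one_le_left r.2 hκ

end Covers

section Suspension

variable {ι : Type*} [Fintype ι] {q y : ι → ℝ}

lemma minRatio_lineMap (hq : ∀ i, 0 < q i) (hy : y ∈ simplexBoundary ι) {t : ℝ} (ht : t ≤ 1) :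
    minRatio q (AffineMap.lineMap y q t) = t := by
  obtain ⟨i, hi⟩ := hy.2
  refine minRatio_eq_of_le hq (fun j => ?_) ⟨i, ?_⟩ <;>
    simp only [AffineMap.lineMap_apply_module, Pi.add_apply, Pi.smul_apply, smul_eq_mul]
  · exact le_add_of_nonneg_left (mul_nonneg (sub_nonneg.2 ht) (hy.1.1 j))
  · rw [hi, mul_zero, zero_add]

lemma lineMap_radialProj_minRatio (hq1 : ∑ i, q i = 1) (hy1 : ∑ i, y i = 1)
    (h : minRatio q y < 1) : AffineMap.lineMap (radialProj q y) q (minRatio q y) = y := by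
  rw [AffineMap.lineMap_apply_module, radialProj, sumNormalize, sum_sub_smul_eq_one_sub hq1 hy1,
    smul_inv_smul₀ (sub_pos.2 h).ne', sub_add_cancel]

variable {X : Type*} [MetricSpace X]

lemma IsLipschitzExtensor.exists_collar_extension [Nonempty ι]
    (hE : IsLipschitzExtensor (simplexBoundary ι) X) {κ : ℝ≥0} (hκ : 0 < κ) (hq : ∀ i, κ ≤ q i)
    (hq1 : ∑ i, q i = 1) :
    ∃ C : ℝ≥0, ∀ (K : ℝ≥0) (A : Set X) (f : X → ι → ℝ) (τ : X → ℝ),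
      LipschitzOnWith K f A → Set.MapsTo f A (stdSimplex ℝ ι) → LipschitzWith K τ → 0 ≤ τ →
      (∀ x ∈ A, minRatio q (f x) = τ x) → (∀ x ∈ A, τ x ≤ 1 / 2) →
      ∃ g : X → ι → ℝ, LipschitzWith (C * K) g ∧ (∀ x, g x ∈ stdSimplex ℝ ι) ∧ Set.EqOn g f A ∧
        ∀ x, τ x ≤ 1 → minRatio q (g x) = τ x := by
  obtain ⟨C, HS⟩ := hE.exists_extension
  have hq0 (i) : 0 < q i := (NNReal.coe_pos.2 hκ).trans_le (hq i)
  have hqΔ : q ∈ stdSimplex ℝ ι := ⟨fun i => (hq0 i).le, hq1⟩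
  set R : ℝ≥0 := (1 + Fintype.card ι) / (1 / 2) * (1 + κ⁻¹)
  refine ⟨C * R + 1, fun K A f τ hf hfΔ hτ hτ0 hfτ hτA => ?_⟩
  have hf_half : Set.MapsTo f A {y | ∑ i, y i = 1 ∧ minRatio q y ≤ 1 - (1 / 2 : ℝ≥0)} :=
    fun x hx => ⟨(hfΔ hx).2, (hfτ x hx).trans_le ((hτA x hx).trans_eq (by norm_num))⟩
  have hf_lt {x} (hx : x ∈ A) : minRatio q (f x) < 1 := (hf_half hx).2.trans_lt (by norm_num)
  obtain ⟨h, hh, hhS, hhf⟩ := HS _ _ (radialProj q ∘ f)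
    ((lipschitzOnWith_radialProj hκ hq hq1 one_half_pos).comp hf hf_half)
    fun x hx => radialProj_mem_simplexBoundary hq0 hq1 (hf_half hx).1 (hf_lt hx)
  have ht01 (x) : min (τ x) 1 ∈ Set.Icc (0 : ℝ) 1 :=
    ⟨le_min (hτ0 x) zero_le_one, min_le_right _ _⟩
  have hg := lipschitzWith_lineMap_of_dist_le (D := 1) hh (.const q) (hτ.min_const 1) ht01
    fun x => dist_le_one_of_mem_stdSimplex (hhS x).1 hqΔ
  refine ⟨_, hg.weaken (le_of_eq (by ring)),
    fun x => (convex_stdSimplex ℝ ι).lineMap_mem (hhS x).1 hqΔ (ht01 x), fun x hx => ?_,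
    fun x hx => ?_⟩
  · have hτx : τ x ≤ 1 := (hτA x hx).trans one_half_lt_one.le
    simp only [hhf hx, Function.comp_apply, min_eq_left hτx]
    rw [← hfτ x hx, lineMap_radialProj_minRatio hq1 (hf_half hx).1 (hf_lt hx)]
  · rw [minRatio_lineMap hq0 (hhS x) (min_le_right _ _), min_eq_left hx]

lemma IsLipschitzExtensor.exists_extension_minRatio_eq [Nonempty ι]
    (hE : IsLipschitzExtensor (simplexBoundary ι) X) {κ : ℝ≥0} (hκ : 0 < κ) (hq : ∀ i, κ ≤ q i)
    (hq1 : ∑ i, q i = 1) :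
    ∃ C : ℝ≥0, ∀ (K : ℝ≥0) (A : Set X) (f : X → ι → ℝ) (τ : X → ℝ),
      LipschitzOnWith K f A → Set.MapsTo f A (stdSimplex ℝ ι) → LipschitzWith K τ → 0 ≤ τ →
      (∀ x ∈ A, minRatio q (f x) = τ x) →
      ∃ g : X → ι → ℝ, LipschitzWith (C * K) g ∧ (∀ x, g x ∈ stdSimplex ℝ ι) ∧ Set.EqOn g f A ∧
        ∀ x, τ x ≤ 1 / 4 → minRatio q (g x) = τ x := by
  obtain ⟨C₀, HΔ⟩ := (isLipschitzExtensor_stdSimplex (ι := ι) (X := X)).exists_extension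
  obtain ⟨C₁, HS⟩ := hE.exists_collar_extension hκ hq hq1
  refine ⟨C₁ + C₀ + 4, fun K A f τ hf hfΔ hτ hτ0 hfτ => ?_⟩
  obtain ⟨u, hu, huΔ, huf⟩ := HΔ K A f hf hfΔ
  obtain ⟨v, hv, hvΔ, hvf, hvτ⟩ := HS K (A ∩ {x | τ x ≤ 1 / 2}) f τ
    (hf.mono Set.inter_subset_left) (hfΔ.mono_left Set.inter_subset_left) hτ hτ0
    (fun x hx => hfτ x hx.1) fun x hx => hx.2
  obtain ⟨w, hw, hw_mem, hw_low, hw_high⟩ := exists_lipschitzWith_interpolation (D := 1) hv hu hτ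
    (fun x => dist_le_one_of_mem_stdSimplex (hvΔ x) (huΔ x)) (1 / 4)
    (show (0 : ℝ≥0) < 1 / 4 by positivity)
  refine ⟨w, hw.weaken (le_of_eq ?_), fun x =>
    (convex_stdSimplex ℝ ι).segment_subset (hvΔ x) (huΔ x) (hw_mem x), fun x hx => ?_,
    fun x hx => ?_⟩
  · rw [div_div_eq_mul_div]
    ring
  · rcases le_total (τ x) (1 / 2) with hτx | hτx
    · simpa only [hvf ⟨hx, hτx⟩, huf hx, segment_same, Set.mem_singleton_iff] using hw_mem x
    · have hquarter : 1 / 4 + ((1 / 4 : ℝ≥0) : ℝ) ≤ τ x := by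
        norm_num
        linarith
      rw [hw_high x hquarter, huf hx]
  · rw [hw_low x hx, hvτ x (hx.trans (by norm_num))]

section Coordinates

variable {k : ℕ} {q y : Fin k → ℝ} {x : Fin (k + 1) → ℝ}

/-- The affine projection of a simplex onto its face opposite to the vertex `0` which sends that
vertex to `q`. It identifies the boundary of the simplex with two copies of the face, glued along
the boundary of the face. -/
def suspProj (q : Fin k → ℝ) (x : Fin (k + 1) → ℝ) : Fin k → ℝ := Fin.tail x + x 0 • q

/-- The signed height over the equator of a point `x` of the boundary of a simplex, viewed as the
suspension of the boundary of the face opposite to the vertex `0`. -/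
noncomputable def suspHeight (q : Fin k → ℝ) (x : Fin (k + 1) → ℝ) : ℝ :=
  x 0 - minRatio q (Fin.tail x)

/-- The point with `suspProj q` equal to `y` and coordinate `0` equal to `c`. -/
def suspPoint (q y : Fin k → ℝ) (c : ℝ) : Fin (k + 1) → ℝ := Fin.cons c (y - c • q)

lemma suspPoint_suspProj : suspPoint q (suspProj q x) (x 0) = x := by
  rw [suspPoint, suspProj, add_sub_cancel_right, Fin.cons_self_tail]

lemma suspProj_mem_stdSimplex (hq : q ∈ stdSimplex ℝ (Fin k))
    (hx : x ∈ stdSimplex ℝ (Fin (k + 1))) : suspProj q x ∈ stdSimplex ℝ (Fin k) := by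
  refine ⟨fun i => add_nonneg (hx.1 _) (mul_nonneg (hx.1 0) (hq.1 i)), ?_⟩
  have hsum := hx.2
  rw [Fin.sum_univ_succ] at hsum
  simp only [suspProj, Pi.add_apply, Pi.smul_apply, smul_eq_mul, Finset.sum_add_distrib,
    ← Finset.mul_sum, hq.2, mul_one]
  rwa [add_comm]

lemma suspPoint_mem_simplexBoundary [NeZero k] (hq : ∀ i, 0 < q i) (hq1 : ∑ i, q i = 1)
    (hy : y ∈ stdSimplex ℝ (Fin k)) {c : ℝ} (hc : c = 0 ∨ c = minRatio q y) :
    suspPoint q y c ∈ simplexBoundary (Fin (k + 1)) := by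
  have hmin : 0 ≤ minRatio q y := minRatio_nonneg hq hy.1
  have hc0 : 0 ≤ c := by rcases hc with rfl | rfl <;> [exact le_rfl; exact hmin]
  have hcy : c ≤ minRatio q y := by rcases hc with rfl | rfl <;> [exact hmin; exact le_rfl]
  refine ⟨⟨fun i => ?_, ?_⟩, ?_⟩
  · cases i using Fin.cases with
    | zero => exact hc0
    | succ i =>
      exact sub_nonneg.2 <|
        (mul_le_mul_of_nonneg_right hcy (hq i).le).trans (minRatio_mul_le hq y i)
  · rw [Fin.sum_univ_succ]
    simp only [suspPoint, Fin.cons_zero, Fin.cons_succ, sum_sub_smul_eq_one_sub hq1 hy.2,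
      add_sub_cancel]
  · rcases hc with rfl | rfl
    · exact ⟨0, rfl⟩
    · obtain ⟨i, hi⟩ := exists_eq_minRatio_mul hq y
      exact ⟨i.succ, sub_eq_zero.2 hi⟩

lemma apply_zero_eq_zero_or_minRatio_tail_eq_zero (hq : ∀ i, 0 < q i)
    (hx : x ∈ simplexBoundary (Fin (k + 1))) : x 0 = 0 ∨ minRatio q (Fin.tail x) = 0 := by
  obtain ⟨i, hi⟩ := hx.2
  induction i using Fin.cases with
  | zero => exact Or.inl hi
  | succ i =>
    refine Or.inr (minRatio_eq_of_le hq (fun j => ?_) ⟨i, ?_⟩) <;> rw [zero_mul]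
    exacts [hx.1.1 _, hi]

lemma minRatio_suspProj [NeZero k] (hq : ∀ i, 0 < q i) (hx : x ∈ simplexBoundary (Fin (k + 1))) :
    minRatio q (suspProj q x) = |suspHeight q x| := by
  have hmin : 0 ≤ minRatio q (Fin.tail x) := minRatio_nonneg hq fun i => hx.1.1 _
  rw [suspProj, minRatio_add_smul hq, suspHeight]
  rcases apply_zero_eq_zero_or_minRatio_tail_eq_zero hq hx with h | h
  · rw [h, add_zero, zero_sub, abs_neg, abs_of_nonneg hmin]
  · rw [h, zero_add, sub_zero, abs_of_nonneg (hx.1.1 0)]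

lemma apply_zero_eq_zero_of_suspHeight_neg (hq : ∀ i, 0 < q i)
    (hx : x ∈ simplexBoundary (Fin (k + 1))) (h : suspHeight q x < 0) : x 0 = 0 := by
  refine (apply_zero_eq_zero_or_minRatio_tail_eq_zero hq hx).resolve_right fun h' => ?_
  rw [suspHeight, h', sub_zero] at h
  exact h.not_ge (hx.1.1 0)

lemma minRatio_suspProj_of_suspHeight_nonneg [NeZero k] (hq : ∀ i, 0 < q i)
    (hx : x ∈ simplexBoundary (Fin (k + 1))) (h : 0 ≤ suspHeight q x) :
    minRatio q (suspProj q x) = x 0 := by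
  have hmin : 0 ≤ minRatio q (Fin.tail x) := minRatio_nonneg hq fun i => hx.1.1 _
  rw [minRatio_suspProj hq hx, abs_of_nonneg h]
  rw [suspHeight] at h ⊢
  rcases apply_zero_eq_zero_or_minRatio_tail_eq_zero hq hx with h' | h' <;> linarith

lemma lipschitzWith_tail : LipschitzWith 1 (Fin.tail : (Fin (k + 1) → ℝ) → Fin k → ℝ) :=
  lipschitzWith_pi fun i => LipschitzWith.eval i.succ

lemma lipschitzWith_suspProj (hq : q ∈ stdSimplex ℝ (Fin k)) :
    LipschitzWith 2 (suspProj q) := by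
  rw [← one_add_one_eq_two]
  exact lipschitzWith_tail.add
    (lipschitzWith_smul_const_of_norm_le_one (.eval 0) (norm_le_one_of_mem_stdSimplex hq))

lemma lipschitzWith_suspHeight [NeZero k] {κ : ℝ≥0} (hκ : 0 < κ) (hq : ∀ i, κ ≤ q i) :
    LipschitzWith (1 + κ⁻¹) (suspHeight q) := by
  have hmin := (lipschitzWith_minRatio hκ hq).comp lipschitzWith_tail
  simpa only [mul_one] using! (LipschitzWith.eval (0 : Fin (k + 1))).sub hmin

lemma lipschitzWith_suspPoint (hq : q ∈ stdSimplex ℝ (Fin k)) {W : X → Fin k → ℝ} {c : X → ℝ}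
    {K L : ℝ≥0} (hW : LipschitzWith K W) (hc : LipschitzWith L c) :
    LipschitzWith (K + L) fun x => suspPoint q (W x) (c x) := by
  have hcq := lipschitzWith_smul_const_of_norm_le_one hc (norm_le_one_of_mem_stdSimplex hq)
  refine lipschitzWith_pi (Fin.cases (hc.weaken le_add_self) fun i => ?_)
  simpa only [one_mul] using! (LipschitzWith.eval i).comp (hW.sub hcq)

end Coordinates

lemma lipschitzWith_indicator_of_eq_abs {φ σ : X → ℝ} {K L : ℝ≥0} (hφ : LipschitzWith K φ)
    (hφ01 : ∀ x, φ x ∈ Set.Icc 0 1) (hσ : LipschitzWith L σ)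
    (hφσ : ∀ x, |σ x| ≤ 1 / 4 → φ x = |σ x|) :
    LipschitzWith (K + 4 * L) ({x | 0 ≤ σ x}.indicator φ) := by
  refine lipschitzWith_indicator (hφ.weaken le_self_add).lipschitzOnWith fun x hx z hz => ?_
  rw [Set.mem_ofPred_eq] at hx
  rw [Set.mem_ofPred_eq, not_le] at hz
  have hφσ' : φ x ≤ 4 * σ x := by
    rcases le_total (σ x) (1 / 4) with h | h
    · have hxσ := hφσ x (by rwa [abs_of_nonneg hx])
      rw [abs_of_nonneg hx] at hxσ
      linarith
    · linarith [(hφ01 x).2]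
  calc ‖φ x‖ = φ x := Real.norm_of_nonneg (hφ01 x).1
    _ ≤ 4 * (σ x - σ z) := by linarith
    _ ≤ 4 * (L * dist x z) := by
      gcongr
      exact (le_abs_self _).trans (hσ.dist_le_mul x z)
    _ ≤ (K + 4 * L : ℝ≥0) * dist x z := by
      push_cast
      linarith [mul_nonneg K.coe_nonneg (dist_nonneg (x := x) (y := z))]

lemma IsLipschitzExtensor.simplexBoundary_succ {k : ℕ} [NeZero k]
    (hE : IsLipschitzExtensor (simplexBoundary (Fin k)) X) :
    IsLipschitzExtensor (simplexBoundary (Fin (k + 1))) X := by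
  set κ : ℝ≥0 := (k : ℝ≥0)⁻¹
  have hκ : 0 < κ := inv_pos.2 (Nat.cast_pos.2 (NeZero.pos k))
  set q : Fin k → ℝ := fun _ => κ
  have hqκ (i) : κ ≤ q i := le_rfl
  have hq0 (i) : 0 < q i := NNReal.coe_pos.2 hκ
  have hq1 : ∑ i, q i = 1 := by simp [q, κ, NeZero.ne k]
  have hqΔ : q ∈ stdSimplex ℝ (Fin k) := ⟨fun i => (hq0 i).le, hq1⟩
  obtain ⟨C, H⟩ := hE.exists_extension_minRatio_eq hκ hqκ hq1
  refine isLipschitzExtensor_of_forall_pos simplexBoundary_nonempty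
    ((C + (κ⁻¹ * C + 4)) * (2 + κ⁻¹)) fun K _ A f hf hfS => ?_
  set L : ℝ≥0 := (2 + κ⁻¹) * K
  obtain ⟨σ, hσ, hσf⟩ := (((lipschitzWith_suspHeight hκ hqκ).comp_lipschitzOnWith hf).weaken
    (mul_le_mul_left (add_le_add_left one_le_two _) _ : (1 + κ⁻¹) * K ≤ L)).extend_real
  obtain ⟨W, hW, hWΔ, hWf, hWσ⟩ := H L A (suspProj q ∘ f) (fun x => |σ x|)
    (((lipschitzWith_suspProj hqΔ).comp_lipschitzOnWith hf).weaken
      (mul_le_mul_left le_self_add _))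
    (fun x hx => suspProj_mem_stdSimplex hqΔ (hfS hx).1)
    (by simpa only [one_mul] using! lipschitzWith_one_norm.comp hσ) (fun x => abs_nonneg _)
    (fun x hx => by rw [← hσf hx]; exact minRatio_suspProj hq0 (hfS hx))
  set c : X → ℝ := {x | 0 ≤ σ x}.indicator fun x => minRatio q (W x)
  have hc : LipschitzWith (κ⁻¹ * (C * L) + 4 * L) c :=
    lipschitzWith_indicator_of_eq_abs ((lipschitzWith_minRatio hκ hqκ).comp hW)
      (fun x => ⟨minRatio_nonneg hq0 (hWΔ x).1, minRatio_le_one hq0 hq1 (hWΔ x)⟩) hσ hWσ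
  refine ⟨fun x => suspPoint q (W x) (c x),
    (lipschitzWith_suspPoint hqΔ hW hc).weaken (le_of_eq (by ring)), fun x => ?_, fun x hx => ?_⟩
  · exact suspPoint_mem_simplexBoundary hq0 hq1 (hWΔ x) (Set.indicator_eq_zero_or_self _ _ _)
  · have hcx : c x = f x 0 := by
      rcases le_or_gt 0 (σ x) with h | h
      · rw [← minRatio_suspProj_of_suspHeight_nonneg hq0 (hfS hx) (h.trans_eq (hσf hx).symm)]
        exact (Set.indicator_of_mem (s := {x | 0 ≤ σ x}) h _).trans (congrArg _ (hWf hx))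
      · rw [apply_zero_eq_zero_of_suspHeight_neg hq0 (hfS hx) ((hσf hx).trans_lt h)]
        exact Set.indicator_of_notMem (s := {x | 0 ≤ σ x}) h.not_ge _
    simp only [hcx, hWf hx, Function.comp_apply, suspPoint_suspProj]

lemma IsLipschitzExtensor.simplexBoundary_mono {m n : ℕ}
    (hE : IsLipschitzExtensor (simplexBoundary (Fin (m + 2))) X) (hmn : m ≤ n) :
    IsLipschitzExtensor (simplexBoundary (Fin (n + 2))) X := by
  induction n, hmn using Nat.le_induction with
  | base => exact hE
  | succ n _ ih => exact ih.simplexBoundary_succ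

lemma NagataDimLE.of_isLipschitzExtensor {m n : ℕ} (h : NagataDimLE X m)
    (hE : IsLipschitzExtensor (simplexBoundary (Fin (n + 2))) X) : NagataDimLE X n := by
  induction m with
  | zero => exact h.mono n.zero_le
  | succ m ih =>
    rcases lt_or_ge m n with hmn | hnm
    · exact h.mono hmn
    · exact ih (h.of_succ (hE.simplexBoundary_mono hnm))

end Suspension

section GenericCenter

lemma exists_mem_forall_notMem_submodule {E α : Type*} [NormedAddCommGroup E] [NormedSpace ℝ E]
    [FiniteDimensional ℝ E] [Countable α] {M : α → Submodule ℝ E} (hM : ∀ a, M a ≠ ⊤) {U : Set E}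
    (hU : IsOpen U) (hU' : U.Nonempty) : ∃ u ∈ U, ∀ a, u ∉ M a := by
  borelize E
  by_contra! hsub
  have hnull : MeasureTheory.Measure.addHaar (⋃ a, (M a : Set E)) = 0 :=
    MeasureTheory.measure_iUnion_null fun a =>
      MeasureTheory.Measure.addHaar_submodule _ (M a) (hM a)
  exact (hU.measure_pos MeasureTheory.Measure.addHaar hU').ne'
    (MeasureTheory.measure_mono_null (fun u hu => Set.mem_iUnion.2 (hsub u hu)) hnull)

lemma continuous_minRatio {ι : Type*} [Finite ι] [Nonempty ι] (q : ι → ℝ) :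
    Continuous (minRatio q) := by
  have := Fintype.ofFinite ι
  have hinf : minRatio q = fun y => Finset.univ.inf' Finset.univ_nonempty fun i => y i / q i :=
    funext fun y => (Finset.inf'_univ_eq_ciInf _).symm
  rw [hinf]
  exact Continuous.finset_inf'_apply _ fun i _ => by fun_prop

variable {ι α : Type*} [Fintype ι] [Fintype α]

lemma exists_mem_stdSimplex_forall_notMem_span [Nonempty ι] {P : Set (ι → ℝ)} (hP : P.Countable)
    (hcard : Fintype.card α < Fintype.card ι) :
    ∃ q ∈ stdSimplex ℝ ι, (∀ i, 1 / (2 * (Fintype.card ι : ℝ)) ≤ q i) ∧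
      ∀ c : α → ι → ℝ, (∀ a, c a ∈ P) → q ∉ Submodule.span ℝ (Set.range c) := by
  have : Countable P := hP
  have hspan (c : α → P) : Submodule.span ℝ (Set.range fun a => (c a : ι → ℝ)) ≠ ⊤ := fun htop => by
    have hrank := finrank_range_le_card (R := ℝ) fun a => (c a : ι → ℝ)
    rw [Set.finrank, htop, finrank_top, Module.finrank_fintype_fun_eq_card] at hrank
    exact hcard.not_ge hrank
  obtain ⟨u, hu, hu_span⟩ := exists_mem_forall_notMem_submodule hspan
    (isOpen_set_pi Set.finite_univ fun _ _ => isOpen_Ioo)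
    (Set.univ_pi_nonempty_iff.2 fun _ : ι => Set.nonempty_Ioo.2 (one_lt_two (α := ℝ)))
  have hu1 (i) : 1 < u i := (hu i trivial).1
  have hu0 : 0 ≤ u := fun i => zero_le_one.trans (hu1 i).le
  have hsum0 : 0 < ∑ i, u i :=
    Finset.sum_pos (fun i _ => one_pos.trans (hu1 i)) Finset.univ_nonempty
  have hsum2 : ∑ i, u i ≤ 2 * Fintype.card ι := by
    simpa only [Finset.card_univ, nsmul_eq_mul, mul_comm] using
      Finset.sum_le_card_nsmul Finset.univ u 2 fun i _ => (hu i trivial).2.le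
  refine ⟨sumNormalize u, sumNormalize_mem_stdSimplex hu0 hsum0, fun i => ?_, fun c hc hq => ?_⟩
  · rw [sumNormalize, Pi.smul_apply, smul_eq_mul, ← div_eq_inv_mul]
    exact div_le_div₀ (hu0 i) (hu1 i).le hsum0 hsum2
  · have hu_mem := Submodule.smul_mem _ (∑ i, u i) hq
    rw [sumNormalize, smul_inv_smul₀ hsum0.ne'] at hu_mem
    exact hu_span (fun a => ⟨c a, hc a⟩) hu_mem

lemma exists_minRatio_le_one_sub_of_notMem [Nonempty ι] {q : ι → ℝ} (hq : ∀ i, 0 < q i)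
    (hq1 : ∑ i, q i = 1) {S : Set (ι → ℝ)} (hS : IsCompact S) (hSΔ : S ⊆ stdSimplex ℝ ι)
    (hqS : q ∉ S) : ∃ ε : ℝ≥0, 0 < ε ∧ ∀ y ∈ S, minRatio q y ≤ 1 - ε := by
  obtain ⟨ε, hε, H⟩ := hS.exists_forall_le' (f := fun y => 1 - minRatio q y)
    (continuous_const.sub (continuous_minRatio q)).continuousOn (a := 0) fun y hy =>
      sub_pos.2 (minRatio_lt_one hq hq1 (hSΔ hy) (ne_of_mem_of_not_mem hy hqS))
  exact ⟨⟨ε, hε.le⟩, hε, fun y hy => le_sub_comm.1 (H y hy)⟩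

lemma exists_minRatio_sum_smul_le_one_sub [Nonempty ι] {q : ι → ℝ} (hq : ∀ i, 0 < q i)
    (hq1 : ∑ i, q i = 1) {P : Set (ι → ℝ)} (hP : IsCompact P) (hPΔ : P ⊆ stdSimplex ℝ ι)
    (hspan : ∀ c : α → ι → ℝ, (∀ a, c a ∈ P) → q ∉ Submodule.span ℝ (Set.range c)) :
    ∃ ε : ℝ≥0, 0 < ε ∧ ∀ c : α → ι → ℝ, (∀ a, c a ∈ P) → ∀ w ∈ stdSimplex ℝ α,
      minRatio q (∑ a, w a • c a) ≤ 1 - ε := by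
  set S : Set (ι → ℝ) := (fun z : (α → ℝ) × (α → ι → ℝ) => ∑ a, z.1 a • z.2 a) ''
    (stdSimplex ℝ α ×ˢ Set.univ.pi fun _ => P)
  have hS : IsCompact S :=
    ((isCompact_stdSimplex ℝ α).prod (isCompact_univ_pi fun _ => hP)).image (by fun_prop)
  have hSΔ : S ⊆ stdSimplex ℝ ι := by
    rintro _ ⟨⟨w, c⟩, ⟨hw, hc⟩, rfl⟩
    exact (convex_stdSimplex ℝ ι).sum_mem (fun a _ => hw.1 a) hw.2 fun a _ => hPΔ (hc a trivial)
  have hqS : q ∉ S := by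
    rintro ⟨⟨w, c⟩, ⟨-, hc⟩, hq⟩
    exact hspan c (fun a => hc a trivial) <| hq ▸ Submodule.sum_mem _ fun a _ =>
      Submodule.smul_mem _ _ (Submodule.subset_span ⟨a, rfl⟩)
  obtain ⟨ε, hε, H⟩ := exists_minRatio_le_one_sub_of_notMem hq hq1 hS hSΔ hqS
  exact ⟨ε, hε, fun c hc w hw => H _ ⟨(w, c), ⟨hw, fun a _ => hc a⟩, rfl⟩⟩

end GenericCenter

section Extension

lemma dist_sum_smul_le_of_mem_stdSimplex {E α : Type*} [NormedAddCommGroup E] [NormedSpace ℝ E]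
    [Fintype α] {w : α → ℝ} (hw : w ∈ stdSimplex ℝ α) {c : α → E} {y : E} {R : ℝ}
    (hc : ∀ a, w a ≠ 0 → dist (c a) y ≤ R) : dist (∑ a, w a • c a) y ≤ R := by
  have hmem := (convex_closedBall y R).finsum_mem hw.1
    (by rw [finsum_eq_sum_of_fintype, hw.2]) hc
  rwa [finsum_eq_sum_of_fintype] at hmem

variable {X : Type*} [MetricSpace X] {n : ℕ}

lemma NagataDimLE.exists_convexCombination_approx {E : Type*} [NormedAddCommGroup E]
    [NormedSpace ℝ E] (h : NagataDimLE X n) {P S : Set E} (hP : ∀ p ∈ P, ‖p‖ ≤ 1) {η : ℝ≥0}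
    (hη : 0 < η) (hPS : ∀ y ∈ S, ∃ p ∈ P, dist p y ≤ η) :
    ∃ C : ℝ≥0, ∀ K : ℝ≥0, 0 < K → ∀ F : X → E, LipschitzWith K F → (∀ x, F x ∈ S) →
      ∃ (w : X → Fin (n + 1) → ℝ) (c : X → Fin (n + 1) → E),
        (∀ x, w x ∈ stdSimplex ℝ (Fin (n + 1))) ∧ (∀ x i, c x i ∈ P) ∧
        LipschitzWith (C * K) (fun x => ∑ i, w x i • c x i) ∧
        ∀ x, dist (∑ i, w x i • c x i) (F x) ≤ 2 * η := by
  obtain ⟨C, hC, H⟩ := h.exists_partition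
  have : 0 < C := two_pos.trans_le hC
  choose! net hnetP hnet using hPS
  refine ⟨(n + 1 : ℕ) * (C * C / η), fun K hK F hF hFS => ?_⟩
  set r : ℝ≥0 := η / (K * C)
  have hr : 0 < r := by positivity
  obtain ⟨w, b, hw, hwΔ, hwb, hb⟩ := H r hr
  set c : X → Fin (n + 1) → E := fun x i => net (F (b i x))
  have hcP (x i) : c x i ∈ P := hnetP _ (hFS _)
  have hcF {x i} (hx : w x i ≠ 0) : dist (c x i) (F x) ≤ 2 * η := by
    calc dist (c x i) (F x) ≤ dist (c x i) (F (b i x)) + dist (F (b i x)) (F x) :=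
        dist_triangle _ _ _
      _ ≤ η + K * dist x (b i x) := by
        rw [dist_comm x]
        exact add_le_add (hnet _ (hFS _)) (hF.dist_le_mul _ _)
      _ ≤ η + K * (C * r) := by
        gcongr
        exact hwb i x hx
      _ = 2 * η := by
        simp only [r]
        push_cast
        field_simp
        ring
  have hCr : (2 : ℝ) ≤ (C / r : ℝ≥0) * r := by
    rw [← NNReal.coe_mul, div_mul_cancel₀ _ hr.ne']
    exact_mod_cast hC
  have hwi (i) : LipschitzWith (C / r) fun x => w x i := by
    simpa only [one_mul] using! (LipschitzWith.eval i).comp hw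
  have hterm (i) : LipschitzWith (C / r) fun x => w x i • c x i :=
    lipschitzWith_smul_of_eq_of_dist_lt (hwi i)
      (fun x => mem_Icc_of_mem_stdSimplex (hwΔ x) i) (fun x => hP _ (hcP x i)) hCr
      fun x y hx hy hxy => by simp only [c, hb i x y hx hy hxy]
  refine ⟨w, c, hwΔ, hcP, (lipschitzWith_finset_sum Finset.univ fun i _ => hterm i).weaken
    (le_of_eq ?_), fun x => dist_sum_smul_le_of_mem_stdSimplex (hwΔ x) fun i => hcF⟩
  rw [Finset.card_univ, Fintype.card_fin]
  simp only [r]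
  field_simp

variable {ι : Type*} [Fintype ι]

lemma NagataDimLE.exists_approx_avoiding_center [Nonempty ι] (h : NagataDimLE X n)
    (hι : n + 1 < Fintype.card ι) :
    ∃ (κ ε C : ℝ≥0) (q : ι → ℝ), 0 < κ ∧ 0 < ε ∧ (∀ i, κ ≤ q i) ∧ ∑ i, q i = 1 ∧
      ∀ K : ℝ≥0, 0 < K → ∀ F : X → ι → ℝ, LipschitzWith K F → (∀ x, F x ∈ stdSimplex ℝ ι) →
        ∃ G : X → ι → ℝ, LipschitzWith (C * K) G ∧ (∀ x, G x ∈ stdSimplex ℝ ι) ∧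
          (∀ x, minRatio q (G x) ≤ 1 - ε) ∧ ∀ x, dist (G x) (F x) ≤ κ / 6 := by
  set κ : ℝ≥0 := 1 / (2 * Fintype.card ι)
  have hκ : 0 < κ := by positivity
  have hη : 0 < κ / 12 := by positivity
  obtain ⟨P, hPΔ, hP, hcover⟩ := (isCompact_stdSimplex ℝ ι).finite_cover_balls
    (NNReal.coe_pos.2 hη)
  have hnet : ∀ y ∈ stdSimplex ℝ ι, ∃ p ∈ P, dist p y ≤ (κ / 12 : ℝ≥0) := fun y hy => by
    obtain ⟨p, hp, hyp⟩ := Set.mem_iUnion₂.1 (hcover hy)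
    exact ⟨p, hp, (Metric.mem_ball'.1 hyp).le⟩
  obtain ⟨q, hqΔ, hqκ, hspan⟩ := exists_mem_stdSimplex_forall_notMem_span (α := Fin (n + 1))
    hP.countable (by rwa [Fintype.card_fin])
  have hqκ (i) : κ ≤ q i := by simpa [κ] using hqκ i
  obtain ⟨ε, hε, H⟩ := exists_minRatio_sum_smul_le_one_sub
    (fun i => (NNReal.coe_pos.2 hκ).trans_le (hqκ i)) hqΔ.2 hP.isCompact hPΔ hspan
  obtain ⟨C, HC⟩ := h.exists_convexCombination_approx
    (fun p hp => norm_le_one_of_mem_stdSimplex (hPΔ hp)) hη hnet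
  refine ⟨κ, ε, C, q, hκ, hε, hqκ, hqΔ.2, fun K hK F hF hFΔ => ?_⟩
  obtain ⟨w, c, hw, hc, hG, hGF⟩ := HC K hK F hF hFΔ
  refine ⟨_, hG, fun x => ?_, fun x => H (c x) (hc x) (w x) (hw x), fun x => (hGF x).trans_eq ?_⟩
  · exact (convex_stdSimplex ℝ ι).sum_mem (fun i _ => (hw x).1 i) (hw x).2
      fun i _ => hPΔ (hc x i)
  · push_cast
    ring

lemma NagataDimLE.exists_approx_avoiding_center_rel_boundary [Nonempty ι] (h : NagataDimLE X n)
    (hι : n + 1 < Fintype.card ι) :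
    ∃ (κ ε C : ℝ≥0) (q : ι → ℝ), 0 < κ ∧ 0 < ε ∧ (∀ i, κ ≤ q i) ∧ ∑ i, q i = 1 ∧
      ∀ K : ℝ≥0, 0 < K → ∀ F : X → ι → ℝ, LipschitzWith K F → (∀ x, F x ∈ stdSimplex ℝ ι) →
        ∃ W : X → ι → ℝ, LipschitzWith (C * K) W ∧ (∀ x, W x ∈ stdSimplex ℝ ι) ∧
          (∀ x, minRatio q (W x) ≤ 1 - ε) ∧ ∀ x, F x ∈ simplexBoundary ι → W x = F x := by
  obtain ⟨κ, ε, C, q, hκ, hε, hqκ, hq1, HG⟩ := h.exists_approx_avoiding_center hι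
  have hq0 (i) : 0 < q i := (NNReal.coe_pos.2 hκ).trans_le (hqκ i)
  refine ⟨κ, min ε (1 / 6), 1 + C + 3 * κ⁻¹, q, hκ, lt_min hε (by positivity), hqκ, hq1,
    fun K hK F hF hFΔ => ?_⟩
  obtain ⟨G, hG, hGΔ, hGε, hGF⟩ := HG K hK F hF hFΔ
  have hmin := lipschitzWith_minRatio hκ hqκ
  obtain ⟨W, hW, hW_mem, hW_low, hW_high⟩ := exists_lipschitzWith_interpolation (D := 1) hF hG
    (hmin.comp hF) (fun x => dist_le_one_of_mem_stdSimplex (hFΔ x) (hGΔ x)) (1 / 3)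
    (show (0 : ℝ≥0) < 1 / 3 by positivity)
  refine ⟨W, hW.weaken (le_of_eq ?_), fun x => ?_, fun x => ?_, fun x hx => ?_⟩
  · rw [div_div_eq_mul_div]
    ring
  · exact (convex_stdSimplex ℝ ι).segment_subset (hFΔ x) (hGΔ x) (hW_mem x)
  · rcases le_total (2 / 3) (minRatio q (F x)) with hx | hx
    · rw [hW_high x ((by norm_num : (1 / 3 + (1 / 3 : ℝ≥0) : ℝ) = 2 / 3).trans_le hx)]
      exact (hGε x).trans (sub_le_sub_left (NNReal.coe_le_coe.2 (min_le_left _ _)) 1)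
    · have hε6 : ((min ε (1 / 6) : ℝ≥0) : ℝ) ≤ 1 / 6 := by simp
      have hWF : dist (W x) (F x) ≤ κ / 6 := by
        rw [dist_comm]
        linarith [dist_add_dist_of_mem_segment (hW_mem x), dist_nonneg (x := W x) (y := G x),
          hGF x, dist_comm (F x) (G x)]
      have hmin_le : minRatio q (W x) - minRatio q (F x) ≤ 1 / 6 :=
        calc minRatio q (W x) - minRatio q (F x) ≤ κ⁻¹ * dist (W x) (F x) :=
            (le_abs_self _).trans (hmin.dist_le_mul (W x) (F x))
          _ ≤ κ⁻¹ * (κ / 6) := by gcongr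
          _ = 1 / 6 := by
            push_cast
            field_simp
      linarith
  · exact hW_low x (by simp [minRatio_eq_zero hq0 hx])

lemma NagataDimLE.isLipschitzExtensor_simplexBoundary [Nontrivial ι] (h : NagataDimLE X n)
    (hι : n + 1 < Fintype.card ι) : IsLipschitzExtensor (simplexBoundary ι) X := by
  obtain ⟨D, HD⟩ := (isLipschitzExtensor_stdSimplex (ι := ι) (X := X)).exists_extension
  obtain ⟨κ, ε, C, q, hκ, hε, hqκ, hq1, HW⟩ := h.exists_approx_avoiding_center_rel_boundary hι
  have hq0 (i) : 0 < q i := (NNReal.coe_pos.2 hκ).trans_le (hqκ i)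
  refine isLipschitzExtensor_of_forall_pos simplexBoundary_nonempty
    ((1 + Fintype.card ι) / ε * (1 + κ⁻¹) * (C * (D + 1))) fun K hK A f hf hfS => ?_
  obtain ⟨F, hF, hFΔ, hFf⟩ := HD K A f hf fun x hx => (hfS hx).1
  replace hF : LipschitzWith ((D + 1) * K) F := hF.weaken (mul_le_mul_left le_self_add K)
  obtain ⟨W, hW, hWΔ, hWε, hWF⟩ := HW ((D + 1) * K) (by positivity) F hF hFΔ
  refine ⟨fun x => radialProj q (W x), ?_, fun x => ?_, fun x hx => ?_⟩
  · refine (lipschitzOnWith_univ.1 ((lipschitzOnWith_radialProj hκ hqκ hq1 hε).comp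
      hW.lipschitzOnWith fun x _ => ⟨(hWΔ x).2, hWε x⟩)).weaken (le_of_eq ?_)
    ring
  · exact radialProj_mem_simplexBoundary hq0 hq1 (hWΔ x).2 ((hWε x).trans_lt (sub_lt_self 1 hε))
  · have hWx : W x = f x := (hWF x (hFf hx ▸ hfS hx)).trans (hFf hx)
    simp only [hWx, radialProj_eq_self hq0 (hfS hx)]

end Extension

theorem mainTheorem1_general {X : Type*} [MetricSpace X] (hX : ∃ m : ℕ, NagataDimLE X m) (n : ℕ)
    (p : ℝ≥0∞) [Fact (1 ≤ p)] :
    IsLipschitzExtensor (simplexSphere p n) X ↔ NagataDimLE X n := by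
  obtain ⟨m, hm⟩ := hX
  rw [isLipschitzExtensor_simplexSphere_iff]
  exact ⟨hm.of_isLipschitzExtensor, fun h => h.isLipschitzExtensor_simplexBoundary (by simp)⟩

/-- Among metric spaces of finite Nagata–Assouad dimension, those of dimension at most `n` are
exactly those of which the `n`-sphere `∂Δ^{n+1}` (with the `ℓ_1` or the `ℓ_2` metric) is a
Lipschitz extensor. -/
theorem mainTheorem1 {X : Type*} [MetricSpace X]
    (hX : ∃ m : ℕ, NagataDimLE X m) (n : ℕ)
    (p : ℝ≥0∞) [Fact (1 ≤ p)] (hp : p = 1 ∨ p = 2) :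
    IsLipschitzExtensor (simplexSphere p n) X ↔ NagataDimLE X n :=
  mainTheorem1_general hX n p
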